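/- Let $\tau\in\mathbb{C}$ be an imaginary quadratic algebraic integer, i.e. a root of $X^2-pX+q$ with $p,q\in\mathbb{Z}$ and $4q-p^2>0$, and suppose $|\tau|>1$. Let $w\ge 2$ be an integer. Let $V=\{z\in\mathbb{C} : |z|\le|z-y| \text{ for all } y\in\mathbb{Z}[\tau]\}$ be the Voronoi cell of $0$ for the lattice $\mathbb{Z}[\tau]$, let $v_0,\dots,v_{m-1}$ be its vertices labelled counter-clockwise (indices modulo $m$, starting at any vertex), and let $v_{k+1/2}$ be the midpoint of the side from $v_k$ to $v_{k+1}$. The restricted Voronoi cell $\widetilde V$ consists of the interior of $V$, the line segments from $v_{k+1/2}$ to $v_{k+1}$ (both end points excluded) for all $k$, the points $v_{k+1/2}$ for $0\le k\le\lfloor m/2\rfloor-1$, and the points $v_k$ for $1\le k\le\lfloor m/3\rfloor$. Let $\mathcal{D}\subseteq\mathbb{Z}[\tau]$ be a minimal norm representatives digit set modulo $\tau^w$: it consists of $0$ and exactly one representative of each residue class of $\mathbb{Z}[\tau]$ modulo $\tau^w$ that is not divisible by $\tau$, and each of these representatives lies in $\tau^w\widetilde V$. A width-$w$ non-adjacent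 form ($w$-NAF) is a sequence $(\xi_j)_{j\in\mathbb{Z}}\in\mathcal{D}^{\mathbb{Z}}$ such that among any $w$ consecutive entries at most one is non-zero. Let $$\mathcal{F}=\Bigl\{\sum_{j\ge 1}\xi_{-j}\tau^{-j} : (\xi_j)_{j\in\mathbb{Z}} \text{ is a } w\text{-NAF with } \xi_j=0 \text{ for all } j\ge 0\Bigr\}$$ be the fundamental domain. Then the Hausdorff dimension of the boundary satisfies $\dim_H\partial\mathcal{F}<2$. In particular, $\partial\mathcal{F}$ has two-dimensional Lebesgue measure $0$. -/

import Mathlib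

open MeasureTheory

namespace WNaf

noncomputable section

/-- The ring `ℤ[τ]`, as a subring of `ℂ`. -/
abbrev ZTau (τ : ℂ) : Subalgebra ℤ ℂ := Algebra.adjoin ℤ {τ}

/-- The generator `τ` as an element of `ℤ[τ]`. -/
def gen (τ : ℂ) : ZTau τ := ⟨τ, Algebra.subset_adjoin (Set.mem_singleton τ)⟩

/-- The Voronoi cell `V` of `0` for the lattice `ℤ[τ]`. -/
def voronoi (τ : ℂ) : Set ℂ := {z | ∀ y : ZTau τ, ‖z‖ ≤ ‖z - (y : ℂ)‖}

/-- `v₀, …, v_{m-1}` are the vertices of the Voronoi cell `V` (the extreme points of this convex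
polygon), each listed once and labelled counter-clockwise, with indices modulo `m`:
walking along the side from `v_k` to `v_{k+1}`, the cell lies on the left-hand side. -/
structure IsVertexLabelling (τ : ℂ) (m : ℕ) (v : ZMod m → ℂ) : Prop where
  injective : Function.Injective v
  range_eq : Set.range v = Set.extremePoints ℝ (voronoi τ)
  counterclockwise : ∀ k : ZMod m, ∀ z ∈ voronoi τ,
    0 ≤ ((starRingEnd ℂ) (v (k + 1) - v k) * (z - v k)).im

/-- The midpoint `v_{k+1/2}` of the side from `v_k` to `v_{k+1}`. -/
def sideMidpoint {m : ℕ} (v : ZMod m → ℂ) (k : ZMod m) : ℂ := midpoint ℝ (v k) (v (k + 1))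

/-- The restricted Voronoi cell of `0`, for a labelling `v` of the `m` vertices: the interior
of `V`, the half sides from `v_{k+1/2}` to `v_{k+1}` without their end points for all `k`, the
points `v_{k+1/2}` for `0 ≤ k ≤ ⌊m/2⌋ - 1`, and the points `v_k` for `1 ≤ k ≤ ⌊m/3⌋`. -/
def restrictedVoronoi (τ : ℂ) (m : ℕ) (v : ZMod m → ℂ) : Set ℂ :=
  interior (voronoi τ)
    ∪ (⋃ k : ZMod m, openSegment ℝ (sideMidpoint v k) (v (k + 1)))
    ∪ {z | ∃ k : ℕ, k < m / 2 ∧ z = sideMidpoint v (k : ZMod m)}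
    ∪ {z | ∃ k : ℕ, 1 ≤ k ∧ k ≤ m / 3 ∧ z = v (k : ZMod m)}

/-- Reduced residue digit set modulo `τ ^ w`: it consists of `0` and exactly one representative
for each residue class of `ℤ[τ]` modulo `τ ^ w` that is not divisible by `τ`. -/
structure IsReducedResidueDigitSet (τ : ℂ) (w : ℕ) (D : Set (ZTau τ)) : Prop where
  zero_mem : 0 ∈ D
  not_dvd : ∀ η ∈ D, η ≠ 0 → ¬ gen τ ∣ η
  existsUnique : ∀ ξ : ZTau τ, ¬ gen τ ∣ ξ → ∃! η : ZTau τ, η ∈ D ∧ gen τ ^ w ∣ η - ξ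

/-- `η` is a representative of minimal norm of its residue class modulo `τ ^ w`: it is not
divisible by `τ`, and it lies in `τ ^ w` times the restricted Voronoi cell. -/
def IsMinNormRep (τ : ℂ) (w m : ℕ) (v : ZMod m → ℂ) (η : ZTau τ) : Prop :=
  ¬ gen τ ∣ η ∧ ∃ z ∈ restrictedVoronoi τ m v, (η : ℂ) = τ ^ w * z

/-- Minimal norm representatives digit set modulo `τ ^ w`. -/
structure IsMinNormDigitSet (τ : ℂ) (w m : ℕ) (v : ZMod m → ℂ) (D : Set (ZTau τ)) : Prop where
  reducedResidue : IsReducedResidueDigitSet τ w D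
  minNorm : ∀ η ∈ D, η ≠ 0 → IsMinNormRep τ w m v η

/-- Width-`w` non-adjacent forms over the digit set `D`: sequences of digits indexed by `ℤ` in
which each block of length `w` contains at most one non-zero digit. -/
structure IsWNaf {τ : ℂ} (w : ℕ) (D : Set (ZTau τ)) (η : ℤ → ZTau τ) : Prop where
  digit_mem : ∀ j, η j ∈ D
  block : ∀ j : ℤ, {i : ℤ | i ∈ Set.Ico j (j + w) ∧ η i ≠ 0}.Subsingleton

/-- The `w`-NAFs of left-length at most `0` and arbitrary right-length, that is, those of the
form `0.η₋₁η₋₂…`. -/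
def fractionalWNafs {τ : ℂ} (w : ℕ) (D : Set (ZTau τ)) : Set (ℤ → ZTau τ) :=
  {η | IsWNaf w D η ∧ ∀ j : ℤ, 0 ≤ j → η j = 0}

/-- The value `∑ η_j τ ^ j` of a digit sequence. The series is absolutely convergent for the
fractional `w`-NAFs over a finite digit set when `|τ| > 1`. -/
def value {τ : ℂ} (η : ℤ → ZTau τ) : ℂ := ∑' j : ℤ, (η j : ℂ) * τ ^ j

/-- The fundamental domain: the set of values of all fractional `w`-NAFs. -/
def fundamentalDomain {τ : ℂ} (w : ℕ) (D : Set (ZTau τ)) : Set ℂ :=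
  value '' fractionalWNafs w D

end

end WNaf

/-!
The fundamental domain `F` is self-similar. The leading digit of a fractional `w`-NAF is either `0`,
and then arbitrary fractional `w`-NAFs may follow, or it is a non-zero digit `d`, and then `w - 1`
zeros and an arbitrary fractional `w`-NAF follow. Hence `F` is the attractor of the maps
`z ↦ z / τ` and `z ↦ d / τ + z / τ ^ w` for `d ∈ D \ {0}`. With `q = |τ|²` there are at most
`(q - 1) q ^ (w - 1)` such digits, because they lie in distinct residue classes modulo `τ ^ w` that
are not divisible by `τ`. So the squares of the contraction ratios have sum at most
`1 / q + (q - 1) q ^ (w - 1) / q ^ w = 1`.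

The interior of `F` is not empty. Running the digit algorithm for `n` steps on an element of `ℤ[τ]`
shows that `τ⁻ⁿ ℤ[τ] ⊆ ℤ[τ] + F`. The union of these sets over `n` is dense and `ℤ[τ] + F` is
closed, so that countably many translates of the compact set `F` cover the plane, and Baire's
theorem applies (`nonempty_interior_fundamentalDomain`).

For such a self-similar set the boundary is small (`dimH_frontier_lt_of_selfSimilar`): iterating the
maps, one finds a cylinder inside the interior of `F`. Each boundary point lies in some cylinder of
the same level, and it must be the image of a boundary point. So the boundary is covered by its
images under the maps of this level without the one of the chosen cylinder. The squares of their
ratios have sum less than `1`, and the same is true for an exponent slightly below `2`, which then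
bounds the dimension. A set of dimension less than `2` is null for the `2`-dimensional Hausdorff
measure, which is a Haar measure on the plane.
-/

namespace WNaf

/-! ### Boundaries of self-similar sets -/

section SelfSimilar

open Set Filter Topology Metric
open scoped NNReal ENNReal

/-- Upper bound for the dimension of a bounded set covered by finitely many contracted copies of
itself: iterating the covering `n` times gives coverings whose `s`-dimensional size is at most
`(∑ ρ_k ^ s) ^ n` times that of `A`, so that the `s`-dimensional Hausdorff measure vanishes. -/
theorem dimH_le_of_subset_iUnion_image {X : Type*} [EMetricSpace X] {κ : Type} [Fintype κ]
    {g : κ → X → X} {ρ : κ → ℝ≥0} {s : ℝ≥0} {A : Set X} (hA : ediam A ≠ ∞)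
    (hg : ∀ k, LipschitzWith (ρ k) (g k)) (hρ : ∀ k, ρ k < 1)
    (hsum : ∑ k, ρ k ^ (s : ℝ) < 1) (hsub : A ⊆ ⋃ k, g k '' A) : dimH A ≤ s := by
  borelize X
  set c : ℝ≥0 := Finset.univ.sup ρ with hc
  have hc1 : c < 1 := (Finset.sup_lt_iff (by simp)).2 fun k _ => hρ k
  have hρc : ∀ k, ρ k ≤ c := fun k => Finset.le_sup (f := ρ) (Finset.mem_univ k)
  set θ : ℝ≥0 := ∑ k, ρ k ^ (s : ℝ) with hθ
  have cover : ∀ n : ℕ, ∃ (ι : Type) (_ : Fintype ι) (t : ι → Set X), A ⊆ ⋃ i, t i ∧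
      (∀ i, ediam (t i) ≤ (c : ℝ≥0∞) ^ n * ediam A) ∧
      ∑ i, ediam (t i) ^ (s : ℝ) ≤ (θ : ℝ≥0∞) ^ n * ediam A ^ (s : ℝ) := by
    intro n
    induction n with
    | zero => exact ⟨Unit, inferInstance, fun _ => A, (iUnion_const A).ge, by simp, by simp⟩
    | succ n ih =>
      obtain ⟨ι, _, t, h1, h2, h3⟩ := ih
      refine ⟨κ × ι, inferInstance, fun x => g x.1 '' t x.2, ?_, ?_, ?_⟩
      · intro x hx
        obtain ⟨k, y, hy, rfl⟩ := mem_iUnion.1 (hsub hx)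
        obtain ⟨i, hi⟩ := mem_iUnion.1 (h1 hy)
        exact mem_iUnion.2 ⟨(k, i), y, hi, rfl⟩
      · rintro ⟨k, i⟩
        calc ediam (g k '' t i) ≤ ρ k * ediam (t i) := (hg k).ediam_image_le _
          _ ≤ c * ((c : ℝ≥0∞) ^ n * ediam A) := by
            gcongr
            · exact hρc k
            · exact h2 i
          _ = _ := by ring
      · calc ∑ x : κ × ι, ediam (g x.1 '' t x.2) ^ (s : ℝ)
            ≤ ∑ x : κ × ι, ((ρ x.1 ^ (s : ℝ) : ℝ≥0) : ℝ≥0∞) * ediam (t x.2) ^ (s : ℝ) := by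
              refine Finset.sum_le_sum fun x _ => ?_
              rw [ENNReal.coe_rpow_of_nonneg _ s.coe_nonneg,
                ← ENNReal.mul_rpow_of_nonneg _ _ s.coe_nonneg]
              exact ENNReal.rpow_le_rpow ((hg x.1).ediam_image_le _) s.coe_nonneg
          _ = (θ : ℝ≥0∞) * ∑ i, ediam (t i) ^ (s : ℝ) := by
              rw [Fintype.sum_prod_type, hθ, ENNReal.ofNNReal_finsetSum, Finset.sum_mul]
              simp_rw [Finset.mul_sum]
          _ ≤ θ * ((θ : ℝ≥0∞) ^ n * ediam A ^ (s : ℝ)) := by gcongr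
          _ = _ := by ring
  choose ι inst t h1 h2 h3 using cover
  have tends : ∀ {a : ℝ≥0} {b : ℝ≥0∞}, a < 1 → b ≠ ∞ →
      Tendsto (fun n : ℕ => (a : ℝ≥0∞) ^ n * b) atTop (𝓝 0) := by
    intro a b ha hb
    have := ENNReal.Tendsto.mul_const (ENNReal.tendsto_pow_atTop_nhds_zero_of_lt_one
      (ENNReal.coe_lt_one_iff.2 ha)) (Or.inr hb)
    simpa using this
  have key := Measure.hausdorffMeasure_le_liminf_sum (s : ℝ) A _ (tends hc1 hA) t
    (Eventually.of_forall h2) (Eventually.of_forall h1)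
  have lim : Tendsto (fun n => ∑ i, ediam (t n i) ^ (s : ℝ)) atTop (𝓝 0) :=
    tendsto_of_tendsto_of_tendsto_of_le_of_le tendsto_const_nhds
      (tends hsum (ENNReal.rpow_ne_top_of_nonneg s.coe_nonneg hA)) (fun _ => zero_le) h3
  rw [lim.liminf_eq] at key
  exact dimH_le_of_hausdorffMeasure_ne_top (ne_top_of_le_ne_top ENNReal.zero_ne_top key)

/-- Composing the maps of an iterated function system `n` times gives a system with the same
attractor and arbitrarily small ratios, whose ratios still satisfy `∑ ρ ^ s ≤ 1`. -/
theorem exists_iterated_ifs {X : Type*} [EMetricSpace X] {ι : Type} [Fintype ι]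
    {f : ι → X ≃ₜ X} {r : ι → ℝ≥0} {s : ℝ} {c : ℝ≥0} {K : Set X}
    (hf : ∀ i, LipschitzWith (r i) (f i)) (hr0 : ∀ i, 0 < r i) (hrc : ∀ i, r i ≤ c)
    (hsum : ∑ i, r i ^ s ≤ 1) (hK : K = ⋃ i, f i '' K) (n : ℕ) :
    ∃ (κ : Type) (_ : Fintype κ) (g : κ → X ≃ₜ X) (ρ : κ → ℝ≥0),
      (∀ k, LipschitzWith (ρ k) (g k)) ∧ (∀ k, 0 < ρ k) ∧ (∀ k, ρ k ≤ c ^ n) ∧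
      ∑ k, ρ k ^ s ≤ 1 ∧ K = ⋃ k, g k '' K := by
  induction n with
  | zero =>
    exact ⟨Unit, inferInstance, fun _ => Homeomorph.refl X, fun _ => 1,
      fun _ => LipschitzWith.id, by simp, by simp, by simp, by simp [iUnion_const]⟩
  | succ n ih =>
    obtain ⟨κ, _, g, ρ, h1, h2, h3, h4, h5⟩ := ih
    refine ⟨ι × κ, inferInstance, fun x => (g x.2).trans (f x.1), fun x => r x.1 * ρ x.2,
      fun x => (hf x.1).comp (h1 x.2), fun x => mul_pos (hr0 _) (h2 _), fun x => ?_, ?_, ?_⟩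
    · rw [pow_succ']
      exact mul_le_mul' (hrc _) (h3 _)
    · rw [Fintype.sum_prod_type]
      simp_rw [NNReal.mul_rpow, ← Finset.mul_sum]
      rw [← Finset.sum_mul]
      exact mul_le_one' hsum h4
    · ext x
      constructor
      · intro hx
        rw [hK] at hx
        obtain ⟨i, y, hy, rfl⟩ := mem_iUnion.1 hx
        rw [h5] at hy
        obtain ⟨k, z, hz, rfl⟩ := mem_iUnion.1 hy
        exact mem_iUnion.2 ⟨(i, k), z, hz, rfl⟩
      · intro hx
        obtain ⟨⟨i, k⟩, z, hz, rfl⟩ := mem_iUnion.1 hx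
        rw [hK]
        refine mem_iUnion.2 ⟨i, g k z, ?_, rfl⟩
        rw [h5]
        exact mem_iUnion.2 ⟨k, z, hz, rfl⟩

/-- If finitely many ratios `ρ_k > 0` satisfy `∑ ρ_k ^ d < 1`, then the same holds for an exponent
that is slightly smaller than `d`. -/
theorem exists_lt_sum_rpow_lt_one {κ : Type*} [Fintype κ] {ρ : κ → ℝ≥0} {d : ℝ≥0} (hd : 0 < d)
    (hρ : ∀ k, 0 < ρ k) (h : ∑ k, ρ k ^ (d : ℝ) < 1) :
    ∃ s : ℝ≥0, s < d ∧ ∑ k, ρ k ^ (s : ℝ) < 1 := by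
  have hcont : Continuous fun s : ℝ≥0 => ∑ k, ρ k ^ (s : ℝ) := by
    refine continuous_finsetSum _ fun k _ => ?_
    exact continuous_iff_continuousAt.2 fun s => (NNReal.continuousAt_rpow (Or.inl (hρ k).ne')).comp
      (f := fun s : ℝ≥0 => (ρ k, (s : ℝ))) (by fun_prop)
  have hev : ∀ᶠ s : ℝ≥0 in 𝓝[<] d, ∑ k, ρ k ^ (s : ℝ) < 1 :=
    (hcont.tendsto d).eventually (gt_mem_nhds h) |>.filter_mono nhdsWithin_le_nhds
  have : (𝓝[<] d).NeBot := nhdsLT_neBot_of_exists_lt ⟨0, hd⟩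
  obtain ⟨s, hs1, hs2⟩ := (hev.and self_mem_nhdsWithin).exists
  exact ⟨s, hs2, hs1⟩

/-- A compact self-similar set with non-empty interior, for maps whose ratios satisfy
`∑ r_i ^ d ≤ 1`, has a boundary of dimension less than `d`. Some cylinder of a high level lies in
the interior, so that the boundary is covered by the copies of itself in all *other* cylinders of
that level, and for these the sum of the `d`-th powers of the ratios is less than `1`. -/
theorem dimH_frontier_lt_of_selfSimilar {X : Type*} [MetricSpace X] {ι : Type} [Fintype ι]
    {f : ι → X ≃ₜ X} {r : ι → ℝ≥0} {d c : ℝ≥0} {K : Set X} (hd : 0 < d)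
    (hf : ∀ i, LipschitzWith (r i) (f i)) (hr0 : ∀ i, 0 < r i) (hrc : ∀ i, r i ≤ c) (hc : c < 1)
    (hsum : ∑ i, r i ^ (d : ℝ) ≤ 1) (hK : K = ⋃ i, f i '' K) (hcomp : IsCompact K)
    (hint : (interior K).Nonempty) : dimH (frontier K) < d := by
  classical
  obtain ⟨x, hx⟩ := hint
  obtain ⟨ε, hε, hball⟩ := Metric.isOpen_iff.1 isOpen_interior x hx
  have hdiam : ediam K ≠ ∞ := hcomp.isBounded.ediam_ne_top
  -- the level at which all cylinders are smaller than `ε`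
  obtain ⟨n, hn0, hn⟩ : ∃ n : ℕ, n ≠ 0 ∧ (c : ℝ≥0∞) ^ n * ediam K < ENNReal.ofReal ε := by
    have h := ENNReal.Tendsto.mul_const (ENNReal.tendsto_pow_atTop_nhds_zero_of_lt_one
      (ENNReal.coe_lt_one_iff.2 hc)) (Or.inr hdiam)
    rw [zero_mul] at h
    obtain ⟨n, h1, h2⟩ := ((h.eventually (gt_mem_nhds (ENNReal.ofReal_pos.2 hε))).and
      (eventually_ne_atTop 0)).exists
    exact ⟨n, h2, h1⟩
  obtain ⟨κ, _, g, ρ, hg, hρ0, hρc, hρsum, hgK⟩ := exists_iterated_ifs hf hr0 hrc hsum hK n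
  have hmem : ∀ k, ∀ y ∈ K, g k y ∈ K := fun k y hy => by
    rw [hgK]
    exact mem_iUnion.2 ⟨k, y, hy, rfl⟩
  obtain ⟨u, y, hy, hyx⟩ : ∃ u, x ∈ g u '' K := by
    have := interior_subset hx
    rw [hgK] at this
    exact mem_iUnion.1 this
  have hu : g u '' K ⊆ interior K := by
    refine Subset.trans ?_ hball
    rintro _ ⟨z, hz, rfl⟩
    rw [← Metric.eball_ofReal, Metric.mem_eball, ← hyx]
    calc edist (g u z) (g u y) ≤ ρ u * edist z y := hg u z y
      _ ≤ (c : ℝ≥0∞) ^ n * ediam K := by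
        gcongr
        · exact_mod_cast hρc u
        · exact edist_le_ediam_of_mem hz hy
      _ < _ := hn
  have hsub : frontier K ⊆ ⋃ k : {k // k ≠ u}, g k '' frontier K := by
    intro z hz
    rw [hcomp.isClosed.frontier_eq] at hz ⊢
    have hzK := hz.1
    rw [hgK] at hzK
    obtain ⟨k, t, ht, rfl⟩ := mem_iUnion.1 hzK
    have hku : k ≠ u := by
      rintro rfl
      exact hz.2 (hu ⟨t, ht, rfl⟩)
    refine mem_iUnion.2 ⟨⟨k, hku⟩, t, ⟨ht, fun hti => hz.2 ?_⟩, rfl⟩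
    have : g k t ∈ interior (g k '' K) := by
      rw [← (g k).image_interior]
      exact ⟨t, hti, rfl⟩
    exact interior_mono (image_subset_iff.2 (hmem k)) this
  have hlt : ∑ k : {k // k ≠ u}, ρ k ^ (d : ℝ) < 1 := by
    have h := Fintype.sum_eq_add_sum_subtype_ne (fun k => ρ k ^ (d : ℝ)) u
    refine lt_of_lt_of_le ?_ (h ▸ hρsum)
    exact lt_add_of_pos_left _ (NNReal.rpow_pos (hρ0 u))
  obtain ⟨s, hsd, hs⟩ := exists_lt_sum_rpow_lt_one hd (fun k : {k // k ≠ u} => hρ0 k) hlt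
  refine lt_of_le_of_lt (dimH_le_of_subset_iUnion_image (κ := {k // k ≠ u})
    (g := fun k => g k) (ρ := fun k => ρ k) ?_ (fun k => hg k) (fun k => ?_) hs hsub)
    (ENNReal.coe_lt_coe.2 hsd)
  · exact ne_top_of_le_ne_top hdiam (ediam_mono hcomp.isClosed.frontier_subset)
  · exact (hρc k).trans_lt (pow_lt_one₀ zero_le hc hn0)

end SelfSimilar

/-! ### The lattice `ℤ[τ]` -/

section Lattice

variable {τ : ℂ} {p q : ℤ}

theorem im_ne_zero_of_quadratic (hτ : τ ^ 2 - (p : ℂ) * τ + (q : ℂ) = 0)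
    (hpq : 0 < 4 * q - p ^ 2) : τ.im ≠ 0 := by
  intro h
  have h1 := congrArg Complex.re hτ
  simp [sq, h] at h1
  have h2 : (0 : ℝ) < 4 * q - p ^ 2 := by exact_mod_cast hpq
  nlinarith [sq_nonneg (2 * τ.re - p)]

theorem two_mul_re_of_quadratic (hτ : τ ^ 2 - (p : ℂ) * τ + (q : ℂ) = 0)
    (hpq : 0 < 4 * q - p ^ 2) : 2 * τ.re = p := by
  have h1 := congrArg Complex.im hτ
  simp [sq] at h1
  refine mul_right_cancel₀ (im_ne_zero_of_quadratic hτ hpq) ?_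
  linarith

theorem normSq_of_quadratic (hτ : τ ^ 2 - (p : ℂ) * τ + (q : ℂ) = 0)
    (hpq : 0 < 4 * q - p ^ 2) : Complex.normSq τ = q := by
  have h1 := congrArg Complex.re hτ
  have h2 := two_mul_re_of_quadratic hτ hpq
  simp [sq] at h1
  rw [Complex.normSq_apply]
  linear_combination h2 * τ.re - h1

theorem coe_gen : ((gen τ : ZTau τ) : ℂ) = τ := rfl

theorem gen_ne_zero (h : 1 < ‖τ‖) : gen τ ≠ 0 := by
  intro h0
  have : τ = 0 := by simpa [coe_gen] using congrArg (fun z : ZTau τ => (z : ℂ)) h0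
  norm_num [this] at h

theorem gen_mul_eq (hτ : τ ^ 2 - (p : ℂ) * τ + (q : ℂ) = 0) :
    gen τ * ((p : ZTau τ) - gen τ) = (q : ZTau τ) := by
  apply Subtype.ext
  push_cast
  rw [coe_gen]
  linear_combination -hτ

theorem exists_gen_dvd_sub_int (z : ZTau τ) : ∃ n : ℤ, gen τ ∣ z - n := by
  obtain ⟨z, hz⟩ := z
  induction hz using Algebra.adjoin_induction with
  | mem x hx =>
    obtain rfl : x = τ := hx
    exact ⟨0, by simp [gen]⟩
  | algebraMap n => exact ⟨n, by
      convert! dvd_zero _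
      rw [sub_eq_zero]
      exact Subtype.ext (by simp)⟩
  | add x y hx hy h1 h2 =>
    obtain ⟨a, ha⟩ := h1
    obtain ⟨b, hb⟩ := h2
    refine ⟨a + b, ?_⟩
    convert! dvd_add ha hb using 1
    apply Subtype.ext
    push_cast
    ring
  | mul x y hx hy h1 h2 =>
    obtain ⟨a, ha⟩ := h1
    obtain ⟨b, hb⟩ := h2
    refine ⟨a * b, ?_⟩
    convert! dvd_add (ha.mul_right ⟨y, hy⟩) (hb.mul_left (a : ZTau τ)) using 1
    apply Subtype.ext
    push_cast
    ring

theorem exists_nat_lt_gen_dvd_sub (hτ : τ ^ 2 - (p : ℂ) * τ + (q : ℂ) = 0) {Q : ℕ}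
    (hQ : (Q : ℤ) = q) (hQ0 : 0 < Q) (z : ZTau τ) : ∃ a < Q, gen τ ∣ z - (a : ZTau τ) := by
  obtain ⟨n, hn⟩ := exists_gen_dvd_sub_int z
  have h0 : 0 ≤ n % (Q : ℤ) := Int.emod_nonneg _ (by omega)
  have h1 : n % (Q : ℤ) < Q := Int.emod_lt_of_pos _ (by omega)
  refine ⟨(n % (Q : ℤ)).toNat, by omega, ?_⟩
  have h2 : (((n % (Q : ℤ)).toNat : ℕ) : ZTau τ) = ((n % (Q : ℤ) : ℤ) : ZTau τ) := by
    conv_rhs => rw [← Int.toNat_of_nonneg h0]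
    rw [Int.cast_natCast]
  have h3 : ((n : ℤ) : ZTau τ) = (Q : ZTau τ) * ((n / (Q : ℤ) : ℤ) : ZTau τ)
      + ((n % (Q : ℤ) : ℤ) : ZTau τ) := by
    have := congrArg (fun k : ℤ => (k : ZTau τ)) (Int.mul_ediv_add_emod n Q)
    push_cast at this
    exact this.symm
  have h4 : gen τ ∣ (Q : ZTau τ) := by
    refine ⟨(p : ZTau τ) - gen τ, ?_⟩
    rw [gen_mul_eq hτ, ← hQ, Int.cast_natCast]
  rw [h2]
  have h5 : z - ((n % (Q : ℤ) : ℤ) : ZTau τ)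
      = (z - n) + (Q : ZTau τ) * ((n / (Q : ℤ) : ℤ) : ZTau τ) := by
    rw [h3]
    ring
  rw [h5]
  exact dvd_add hn (h4.mul_right _)

/-- There are at most `q ^ w` residue classes modulo `τ ^ w`. -/
theorem exists_finset_representatives (hτ : τ ^ 2 - (p : ℂ) * τ + (q : ℂ) = 0) {Q : ℕ}
    (hQ : (Q : ℤ) = q) (hQ0 : 0 < Q) (w : ℕ) :
    ∃ R : Finset (ZTau τ), R.card ≤ Q ^ w ∧ ∀ z : ZTau τ, ∃ r ∈ R, gen τ ^ w ∣ z - r := by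
  classical
  induction w with
  | zero => exact ⟨{0}, by simp, fun z => ⟨0, by simp⟩⟩
  | succ w ih =>
    obtain ⟨R, hR, h⟩ := ih
    refine ⟨Finset.image₂ (fun (a : ℕ) r => (a : ZTau τ) + gen τ * r) (Finset.range Q) R,
      ?_, fun z => ?_⟩
    · refine (Finset.card_image₂_le _ _ _).trans ?_
      rw [Finset.card_range, pow_succ']
      exact Nat.mul_le_mul_left _ hR
    · obtain ⟨a, ha, y, hy⟩ := exists_nat_lt_gen_dvd_sub hτ hQ hQ0 z
      obtain ⟨r, hr, hd⟩ := h y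
      refine ⟨_, Finset.mem_image₂_of_mem (Finset.mem_range.2 ha) hr, ?_⟩
      have : z - ((a : ZTau τ) + gen τ * r) = gen τ * (y - r) := by
        rw [mul_sub, ← hy]
        ring
      rw [this, pow_succ']
      exact mul_dvd_mul_left _ hd

/-- At most `(q - 1) q ^ w` residue classes modulo `τ ^ (w + 1)` are not divisible by `τ`: the
lowest digit to the base `τ` of such a class is not `0`. -/
theorem exists_finset_representatives_not_dvd (hτ : τ ^ 2 - (p : ℂ) * τ + (q : ℂ) = 0) {Q : ℕ}
    (hQ : (Q : ℤ) = q) (hQ0 : 0 < Q) (w : ℕ) :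
    ∃ R : Finset (ZTau τ), R.card ≤ (Q - 1) * Q ^ w ∧
      ∀ z : ZTau τ, ¬ gen τ ∣ z → ∃ r ∈ R, gen τ ^ (w + 1) ∣ z - r := by
  classical
  obtain ⟨R, hR, h⟩ := exists_finset_representatives hτ hQ hQ0 w
  refine ⟨Finset.image₂ (fun (a : ℕ) r => (a : ZTau τ) + gen τ * r)
    ((Finset.range Q).erase 0) R, ?_, fun z hz => ?_⟩
  · refine (Finset.card_image₂_le _ _ _).trans ?_
    rw [Finset.card_erase_of_mem (Finset.mem_range.2 hQ0), Finset.card_range]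
    exact Nat.mul_le_mul_left _ hR
  · obtain ⟨a, ha, y, hy⟩ := exists_nat_lt_gen_dvd_sub hτ hQ hQ0 z
    have ha0 : a ≠ 0 := by
      rintro rfl
      exact hz ⟨y, by simpa using hy⟩
    obtain ⟨r, hr, hd⟩ := h y
    refine ⟨_, Finset.mem_image₂_of_mem (Finset.mem_erase.2 ⟨ha0, Finset.mem_range.2 ha⟩) hr, ?_⟩
    have : z - ((a : ZTau τ) + gen τ * r) = gen τ * (y - r) := by
      rw [mul_sub, ← hy]
      ring
    rw [this, pow_succ']
    exact mul_dvd_mul_left _ hd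

/-- A reduced residue digit set has at most `(q - 1) q ^ (w - 1)` non-zero digits. -/
theorem IsReducedResidueDigitSet.finite_and_ncard_le {D : Set (ZTau τ)} {w : ℕ}
    (hD : IsReducedResidueDigitSet τ (w + 1) D) (hτ : τ ^ 2 - (p : ℂ) * τ + (q : ℂ) = 0)
    {Q : ℕ} (hQ : (Q : ℤ) = q) (hQ0 : 0 < Q) :
    (D \ {0}).Finite ∧ (D \ {0}).ncard ≤ (Q - 1) * Q ^ w := by
  classical
  obtain ⟨R, hR, h⟩ := exists_finset_representatives_not_dvd hτ hQ hQ0 w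
  choose! φ hφ1 hφ2 using h
  have hmaps : ∀ η ∈ D \ {0}, φ η ∈ (R : Set (ZTau τ)) := fun η hη =>
    hφ1 η (hD.not_dvd η hη.1 hη.2)
  have hinj : Set.InjOn φ (D \ {0}) := by
    intro η hη η' hη' heq
    have hn := hD.not_dvd η hη.1 hη.2
    have hn' := hD.not_dvd η' hη'.1 hη'.2
    refine (hD.existsUnique η hn).unique ⟨hη.1, by simp⟩ ⟨hη'.1, ?_⟩
    have := dvd_sub (hφ2 η' hn') (hφ2 η hn)
    rw [heq] at this
    simpa using this
  exact ⟨Set.Finite.of_injOn hmaps hinj R.finite_toSet,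
    (Set.ncard_le_ncard_of_injOn φ hmaps hinj R.finite_toSet).trans
      (by rwa [Set.ncard_coe_finset])⟩

theorem exists_eq_add_mul (hτ : τ ^ 2 - (p : ℂ) * τ + (q : ℂ) = 0) (z : ZTau τ) :
    ∃ x y : ℤ, (z : ℂ) = x + y * τ := by
  obtain ⟨z, hz⟩ := z
  induction hz using Algebra.adjoin_induction with
  | mem x hx => exact ⟨0, 1, by simpa using hx⟩
  | algebraMap n => exact ⟨n, 0, by simp⟩
  | add x y hx hy h1 h2 =>
    obtain ⟨a, b, h1⟩ := h1
    obtain ⟨c, d, h2⟩ := h2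
    refine ⟨a + c, b + d, ?_⟩
    push_cast
    linear_combination h1 + h2
  | mul x y hx hy h1 h2 =>
    obtain ⟨a, b, h1⟩ := h1
    obtain ⟨c, d, h2⟩ := h2
    refine ⟨a * c - q * (b * d), a * d + b * c + p * (b * d), ?_⟩
    dsimp only at h1 h2 ⊢
    rw [h1, h2]
    push_cast
    linear_combination (b * d : ℂ) * hτ

/-- Non-zero elements of `ℤ[τ]` have norm at least `1`, since `|x + yτ|² = x² + pxy + qy²` is an
integer. -/
theorem one_le_norm_of_mem (hτ : τ ^ 2 - (p : ℂ) * τ + (q : ℂ) = 0)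
    (hpq : 0 < 4 * q - p ^ 2) {z : ZTau τ} (hz : (z : ℂ) ≠ 0) : 1 ≤ ‖(z : ℂ)‖ := by
  obtain ⟨x, y, h⟩ := exists_eq_add_mul hτ z
  have h1 : Complex.normSq z = ((x ^ 2 + p * x * y + q * y ^ 2 : ℤ) : ℝ) := by
    have h2 := two_mul_re_of_quadratic hτ hpq
    have h3 := normSq_of_quadratic hτ hpq
    rw [Complex.normSq_apply] at h3 ⊢
    rw [h]
    simp
    linear_combination (x * y : ℝ) * h2 + (y : ℝ) ^ 2 * h3
  have h2 := Complex.normSq_pos.2 hz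
  rw [h1] at h2
  have h3 : (1 : ℝ) ≤ ((x ^ 2 + p * x * y + q * y ^ 2 : ℤ) : ℝ) := by
    exact_mod_cast Int.cast_pos.1 h2
  rw [← h1, Complex.normSq_eq_norm_sq] at h3
  exact (one_le_sq_iff₀ (norm_nonneg _)).1 h3

theorem isClosed_range_coe (hτ : τ ^ 2 - (p : ℂ) * τ + (q : ℂ) = 0)
    (hpq : 0 < 4 * q - p ^ 2) : IsClosed (Set.range ((↑) : ZTau τ → ℂ)) := by
  refine Metric.isClosed_of_pairwise_le_dist one_pos ?_
  rintro _ ⟨x, rfl⟩ _ ⟨y, rfl⟩ hne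
  have := one_le_norm_of_mem hτ hpq (z := x - y) (by simpa [sub_eq_zero] using hne)
  rwa [dist_eq_norm]

theorem exists_norm_sub_le (him : τ.im ≠ 0) (z : ℂ) :
    ∃ y : ZTau τ, ‖z - y‖ ≤ 1 + ‖τ‖ := by
  set t : ℝ := z.im / τ.im with ht
  set s : ℝ := z.re - t * τ.re with hs
  have hz : z = s + t * τ := by
    apply Complex.ext
    · simp [hs]
    · simp [ht, him]
  refine ⟨(round s : ZTau τ) + (round t : ZTau τ) * gen τ, ?_⟩
  have : z - ((round s : ZTau τ) + (round t : ZTau τ) * gen τ : ZTau τ)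
      = ((s - round s : ℝ) : ℂ) + ((t - round t : ℝ) : ℂ) * τ := by
    rw [hz]
    push_cast
    rw [coe_gen]
    ring
  rw [this]
  refine (norm_add_le _ _).trans ?_
  rw [norm_mul, Complex.norm_real, Complex.norm_real]
  have h1 := abs_sub_round s
  have h2 := abs_sub_round t
  rw [Real.norm_eq_abs, Real.norm_eq_abs]
  have := norm_nonneg τ
  nlinarith

/-- The points of `ℤ[τ]` divided by powers of `τ` are dense in the plane. -/
theorem exists_norm_sub_div_pow_lt (him : τ.im ≠ 0) (h1 : 1 < ‖τ‖) (z : ℂ) {ε : ℝ} (hε : 0 < ε) :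
    ∃ (n : ℕ) (y : ZTau τ), ‖z - (y : ℂ) / τ ^ n‖ < ε := by
  obtain ⟨n, hn⟩ := pow_unbounded_of_one_lt ((1 + ‖τ‖) / ε) h1
  obtain ⟨y, hy⟩ := exists_norm_sub_le him (z * τ ^ n)
  refine ⟨n, y, ?_⟩
  have hτ0 : τ ≠ 0 := fun h => him (by simp [h])
  have hpos : 0 < ‖τ‖ ^ n := pow_pos (by linarith) n
  have : z - (y : ℂ) / τ ^ n = (z * τ ^ n - y) / τ ^ n := by
    field_simp
  rw [this, norm_div, norm_pow, div_lt_iff₀ hpos]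
  rw [div_lt_iff₀ hε] at hn
  linarith

theorem countable_ZTau (hτ : τ ^ 2 - (p : ℂ) * τ + (q : ℂ) = 0) : Countable (ZTau τ) := by
  choose x y h using exists_eq_add_mul hτ
  refine Function.Injective.countable (f := fun z => (x z, y z)) fun z z' hz => ?_
  rw [Prod.mk.injEq] at hz
  exact Subtype.ext (by rw [h z, h z', hz.1, hz.2])

end Lattice

section Naf

variable {τ : ℂ} {p q : ℤ} {w : ℕ} {D : Set (ZTau τ)}

/-! ### Values of fractional `w`-NAFs -/

theorem isWNaf_iff {η : ℤ → ZTau τ} : IsWNaf w D η ↔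
    (∀ j, η j ∈ D) ∧ ∀ i i' : ℤ, i < i' → i' < i + w → η i = 0 ∨ η i' = 0 := by
  constructor
  · rintro ⟨h1, h2⟩
    refine ⟨h1, fun i i' hi hi' => ?_⟩
    by_contra! hne
    have := h2 i ⟨⟨le_rfl, by omega⟩, hne.1⟩ ⟨⟨hi.le, hi'⟩, hne.2⟩
    omega
  · rintro ⟨h1, h2⟩
    refine ⟨h1, fun j i hi i' hi' => ?_⟩
    obtain ⟨⟨hi1, hi2⟩, hi3⟩ := hi
    obtain ⟨⟨hi1', hi2'⟩, hi3'⟩ := hi'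
    rcases lt_trichotomy i i' with h | h | h
    · rcases h2 i i' h (by omega) with h | h <;> contradiction
    · exact h
    · rcases h2 i' i h (by omega) with h | h <;> contradiction

theorem IsWNaf.shift {η : ℤ → ZTau τ} (h : IsWNaf w D η) (k : ℤ) :
    IsWNaf w D fun j => η (j + k) := by
  rw [isWNaf_iff] at h ⊢
  exact ⟨fun j => h.1 _, fun i i' h1 h2 => h.2 _ _ (by omega) (by omega)⟩

theorem value_shift (hτ0 : τ ≠ 0) (η : ℤ → ZTau τ) (k : ℤ) :
    value (fun j => η (j + k)) = τ ^ (-k) * value η := by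
  unfold value
  rw [← tsum_mul_left, ← (Equiv.addRight k).tsum_eq fun j : ℤ => τ ^ (-k) * ((η j : ℂ) * τ ^ j)]
  refine tsum_congr fun j => ?_
  rw [Equiv.coe_addRight, zpow_add₀ hτ0, zpow_neg]
  have := zpow_ne_zero k hτ0
  field_simp

/-- Bound for the terms of the series of a fractional `w`-NAF with digits of norm at most `M`. -/
noncomputable def termBound (τ : ℂ) (M : ℝ) (j : ℤ) : ℝ := if j < 0 then M * ‖τ‖ ^ j else 0

theorem summable_termBound (h1 : 1 < ‖τ‖) (M : ℝ) : Summable (termBound τ M) := by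
  apply Summable.of_nat_of_neg
  · have h0 : ∀ n : ℕ, termBound τ M n = 0 := fun n => if_neg (by omega)
    simp only [h0]
    exact summable_zero
  · have hg : Summable fun n : ℕ => |M| * (‖τ‖⁻¹) ^ n :=
      (summable_geometric_of_lt_one (by positivity) (inv_lt_one_of_one_lt₀ h1)).mul_left _
    refine hg.of_norm_bounded fun n => ?_
    unfold termBound
    split_ifs
    · simp
    · simpa using by positivity

theorem norm_term_le {M : ℝ} (hM : ∀ η ∈ D, ‖(η : ℂ)‖ ≤ M) {η : ℤ → ZTau τ}
    (hη : η ∈ fractionalWNafs w D) (j : ℤ) : ‖(η j : ℂ) * τ ^ j‖ ≤ termBound τ M j := by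
  unfold termBound
  split_ifs with h
  · rw [norm_mul, norm_zpow]
    exact mul_le_mul_of_nonneg_right (hM _ (hη.1.digit_mem j)) (by positivity)
  · simp [hη.2 j (by omega)]

theorem exists_norm_le (hfin : D.Finite) : ∃ M : ℝ, ∀ η ∈ D, ‖(η : ℂ)‖ ≤ M := by
  obtain ⟨M, hM⟩ := (hfin.image fun η : ZTau τ => ‖(η : ℂ)‖).bddAbove
  exact ⟨M, fun η hη => hM ⟨η, hη, rfl⟩⟩

theorem isCompact_fractionalWNafs (hfin : D.Finite) : IsCompact (fractionalWNafs w D) := by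
  have hpi : IsCompact (Set.univ.pi fun _ : ℤ => D) := isCompact_univ_pi fun _ => hfin.isCompact
  refine hpi.of_isClosed_subset ?_ fun η hη j _ => hη.1.digit_mem j
  have hzero : ∀ j : ℤ, IsClosed {η : ℤ → ZTau τ | η j = 0} := fun j =>
    isClosed_eq (continuous_apply j) continuous_const
  have heq : fractionalWNafs w D = (⋂ j : ℤ, {η | η j ∈ D}) ∩
      (⋂ (i : ℤ) (i' : ℤ) (_ : i < i') (_ : i' < i + w), {η | η i = 0} ∪ {η | η i' = 0}) ∩
      ⋂ (j : ℤ) (_ : 0 ≤ j), {η | η j = 0} := by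
    ext η
    simp [fractionalWNafs, isWNaf_iff]
  rw [heq]
  refine ((isClosed_iInter fun j => hfin.isClosed.preimage (continuous_apply j)).inter ?_).inter ?_
  · exact isClosed_iInter fun i => isClosed_iInter fun i' => isClosed_iInter fun _ =>
      isClosed_iInter fun _ => (hzero i).union (hzero i')
  · exact isClosed_iInter fun j => isClosed_iInter fun _ => hzero j

theorem isCompact_fundamentalDomain (h1 : 1 < ‖τ‖) (hfin : D.Finite) :
    IsCompact (fundamentalDomain w D) := by
  obtain ⟨M, hM⟩ := exists_norm_le hfin
  refine (isCompact_fractionalWNafs hfin).image_of_continuousOn ?_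
  unfold value
  refine continuousOn_tsum (fun j => ?_) (summable_termBound h1 M)
    fun j η hη => norm_term_le hM hη j
  exact (by fun_prop : Continuous fun η : ℤ → ZTau τ => (η j : ℂ) * τ ^ j).continuousOn

/-! ### Self-similarity of the fundamental domain -/

/-- The sequence `0.d0…0η₋₁η₋₂…` with `w - 1` zeros after the digit `d`. -/
def prepend (w : ℕ) (d : ZTau τ) (η : ℤ → ZTau τ) : ℤ → ZTau τ :=
  fun j => if j = -1 then d else η (j + w)

theorem prepend_mem {d : ZTau τ} (hd : d ∈ D) {η : ℤ → ZTau τ}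
    (hη : η ∈ fractionalWNafs w D) : prepend w d η ∈ fractionalWNafs w D := by
  obtain ⟨h, h0⟩ := hη
  rw [isWNaf_iff] at h
  refine ⟨isWNaf_iff.2 ⟨fun j => ?_, fun i i' hi hi' => ?_⟩, fun j hj => ?_⟩
  · unfold prepend
    split_ifs
    exacts [hd, h.1 _]
  · unfold prepend
    split_ifs with h2 h3 h3
    · omega
    · exact Or.inr (h0 _ (by omega))
    · exact Or.inl (h0 _ (by omega))
    · exact h.2 _ _ (by omega) (by omega)
  · unfold prepend
    rw [if_neg (by omega)]
    exact h0 _ (by omega)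

theorem value_prepend (h1 : 1 < ‖τ‖) (hw : 1 ≤ w) (hfin : D.Finite) {d : ZTau τ} (hd : d ∈ D)
    {η : ℤ → ZTau τ} (hη : η ∈ fractionalWNafs w D) :
    value (prepend w d η) = d * τ⁻¹ + (τ ^ w)⁻¹ * value η := by
  have hτ0 : τ ≠ 0 := fun h => by norm_num [h] at h1
  obtain ⟨M, hM⟩ := exists_norm_le hfin
  have hs : Summable fun j : ℤ => (prepend w d η j : ℂ) * τ ^ j :=
    (summable_termBound h1 M).of_norm_bounded fun j => norm_term_le hM (prepend_mem hd hη) j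
  have h2 := value_shift hτ0 η w
  rw [zpow_neg, zpow_natCast] at h2
  rw [← h2]
  unfold value
  rw [hs.tsum_eq_add_tsum_ite (-1)]
  congr 1
  · simp [prepend]
  · refine tsum_congr fun j => ?_
    split_ifs with hj
    · simp [hη.2 (j + w) (by omega)]
    · simp [prepend, hj]

theorem inv_mul_mem_fundamentalDomain (hτ0 : τ ≠ 0) {z : ℂ} (hz : z ∈ fundamentalDomain w D) :
    τ⁻¹ * z ∈ fundamentalDomain w D := by
  obtain ⟨η, hη, rfl⟩ := hz
  refine ⟨fun j => η (j + 1), ⟨hη.1.shift 1, fun j hj => hη.2 _ (by omega)⟩, ?_⟩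
  rw [value_shift hτ0, zpow_neg_one]

theorem digit_add_mul_mem_fundamentalDomain (h1 : 1 < ‖τ‖) (hw : 1 ≤ w) (hfin : D.Finite)
    {d : ZTau τ} (hd : d ∈ D) {z : ℂ} (hz : z ∈ fundamentalDomain w D) :
    d * τ⁻¹ + (τ ^ w)⁻¹ * z ∈ fundamentalDomain w D := by
  obtain ⟨η, hη, rfl⟩ := hz
  exact ⟨_, prepend_mem hd hη, value_prepend h1 hw hfin hd hη⟩

/-- Splitting a fractional `w`-NAF after its leading digit: either this digit is `0`, or it is
followed by `w - 1` zeros. -/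
theorem exists_of_mem_fundamentalDomain (h1 : 1 < ‖τ‖) (hw : 1 ≤ w) (hfin : D.Finite)
    (h0 : 0 ∈ D) {z : ℂ} (hz : z ∈ fundamentalDomain w D) :
    (∃ y ∈ fundamentalDomain w D, z = τ⁻¹ * y) ∨
      ∃ d ∈ D \ {0}, ∃ y ∈ fundamentalDomain w D, z = d * τ⁻¹ + (τ ^ w)⁻¹ * y := by
  have hτ0 : τ ≠ 0 := fun h => by norm_num [h] at h1
  obtain ⟨η, hη, rfl⟩ := hz
  by_cases hd : η (-1) = 0
  · left
    refine ⟨value fun j => η (j + -1), ⟨_, ⟨hη.1.shift (-1), fun j hj => ?_⟩, rfl⟩, ?_⟩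
    · rcases hj.eq_or_lt with rfl | hj
      · simpa using hd
      · exact hη.2 _ (by omega)
    · rw [value_shift hτ0, neg_neg, zpow_one, inv_mul_cancel_left₀ hτ0]
  · right
    have hnaf := isWNaf_iff.1 hη.1
    refine ⟨η (-1), ⟨hnaf.1 _, hd⟩, ?_⟩
    -- the tail of `η` behind the first `w` fractional digits
    set η' : ℤ → ZTau τ := fun j => if j < 0 then η (j - w) else 0 with hη'
    have hmem : η' ∈ fractionalWNafs w D := by
      refine ⟨isWNaf_iff.2 ⟨fun j => ?_, fun i i' hi hi' => ?_⟩, fun j hj => ?_⟩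
      · simp only [hη']
        split_ifs
        exacts [hnaf.1 _, h0]
      · simp only [hη']
        split_ifs
        · exact hnaf.2 _ _ (by omega) (by omega)
        · exact Or.inr rfl
        · exact Or.inl rfl
        · exact Or.inl rfl
      · simp only [hη']
        rw [if_neg (by omega)]
    have heq : prepend w (η (-1)) η' = η := by
      funext j
      simp only [prepend, hη']
      split_ifs with h2 h3
      · rw [h2]
      · congr 1
        omega
      · rcases le_or_gt 0 j with hj | hj
        · exact (hη.2 j hj).symm
        · exact ((hnaf.2 j (-1) (by omega) (by omega)).resolve_right hd).symm
    exact ⟨value η', ⟨η', hmem, rfl⟩, by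
      rw [← value_prepend h1 hw hfin (hnaf.1 _) hmem, heq]⟩

/-! ### The lattice translates of the fundamental domain cover the plane -/

/-- The digit algorithm, splitting off the `w`-NAF digits of an element of `ℤ[τ]` from the lowest
one upwards. -/
theorem IsReducedResidueDigitSet.exists_digit_rem (hD : IsReducedResidueDigitSet τ w D)
    (hw : 1 ≤ w) : ∃ δ ρ : ZTau τ → ZTau τ, ∀ z, δ z ∈ D ∧ (gen τ ∣ z → δ z = 0) ∧
      (¬ gen τ ∣ z → gen τ ^ w ∣ z - δ z) ∧ z = δ z + gen τ * ρ z := by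
  have : ∀ z : ZTau τ, ∃ d r : ZTau τ, d ∈ D ∧ (gen τ ∣ z → d = 0) ∧
      (¬ gen τ ∣ z → gen τ ^ w ∣ z - d) ∧ z = d + gen τ * r := by
    intro z
    by_cases hz : gen τ ∣ z
    · obtain ⟨r, hr⟩ := hz
      exact ⟨0, r, hD.zero_mem, fun _ => rfl, fun h => absurd ⟨r, hr⟩ h, by rw [zero_add, hr]⟩
    · obtain ⟨d, hd, -⟩ := hD.existsUnique z hz
      have hdvd : gen τ ^ w ∣ z - d := by
        rw [← neg_sub, dvd_neg]
        exact hd.2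
      obtain ⟨r, hr⟩ := (dvd_pow_self (gen τ) (by omega)).trans hdvd
      exact ⟨d, r, hd.1, fun h => absurd h hz, fun _ => hdvd, by rw [← hr]; ring⟩
  choose δ ρ h using this
  exact ⟨δ, ρ, h⟩

/-- After `n` steps of the digit algorithm, an element of `ℤ[τ]` is `∑_{j<n} ξ_j τ^j + τ^n y` with
a `w`-NAF `ξ` and `y ∈ ℤ[τ]`. Dividing by `τ^n` shows that `τ^{-n} ℤ[τ]` lies in the union of the
lattice translates of the fundamental domain. -/
theorem IsReducedResidueDigitSet.exists_sub_mem_fundamentalDomain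
    (hD : IsReducedResidueDigitSet τ w D) (h1 : 1 < ‖τ‖) (hw : 1 ≤ w) (z : ZTau τ) (n : ℕ) :
    ∃ y : ZTau τ, (z : ℂ) / τ ^ n - y ∈ fundamentalDomain w D := by
  have hτ0 : τ ≠ 0 := fun h => by norm_num [h] at h1
  obtain ⟨δ, ρ, h⟩ := hD.exists_digit_rem hw
  choose hmem hdvd hndvd heq using h
  set s : ℕ → ZTau τ := fun j => ρ^[j] z with hs
  have hsucc : ∀ j, s (j + 1) = ρ (s j) := fun j => Function.iterate_succ_apply' ρ j z
  have hsum : ∀ n, (z : ℂ) = ∑ j ∈ Finset.range n, (δ (s j) : ℂ) * τ ^ j + τ ^ n * s n := by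
    intro n
    induction n with
    | zero => simp [hs]
    | succ n ih =>
      have h2 := congrArg (fun y : ZTau τ => (y : ℂ)) (heq (s n))
      simp only [← hsucc] at h2
      push_cast at h2
      rw [coe_gen] at h2
      rw [Finset.sum_range_succ, pow_succ]
      linear_combination ih + τ ^ n * h2
  have hg := gen_ne_zero h1
  -- a non-zero digit leaves a remainder that is divisible by `τ` for the next `w - 1` steps
  have hdiv : ∀ j, ¬ gen τ ∣ s j → ∀ i, i < w → gen τ ^ (w - (i + 1)) ∣ s (j + (i + 1)) := by
    intro j hj i
    induction i with
    | zero =>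
      intro _
      have h2 := hndvd _ hj
      have h3 : s j - δ (s j) = gen τ * s (j + 1) := by
        rw [hsucc, sub_eq_iff_eq_add']
        exact heq _
      rw [h3, show w = (w - 1) + 1 by omega, pow_succ'] at h2
      exact (mul_dvd_mul_iff_left hg).1 h2
    | succ i ih =>
      intro hi
      have h2 := ih (by omega)
      have h4 : gen τ ∣ s (j + (i + 1)) := (dvd_pow_self _ (by omega)).trans h2
      have h3 : s (j + (i + 1)) = gen τ * s (j + (i + 1 + 1)) := by
        rw [← add_assoc j (i + 1) 1, hsucc]
        conv_lhs => rw [heq (s (j + (i + 1))), hdvd _ h4, zero_add]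
      rw [h3, show w - (i + 1) = (w - (i + 1 + 1)) + 1 by omega, pow_succ'] at h2
      exact (mul_dvd_mul_iff_left hg).1 h2
  have hblock : ∀ j k, j < k → k < j + w → δ (s j) = 0 ∨ δ (s k) = 0 := by
    intro j k hjk hk
    by_cases hj : gen τ ∣ s j
    · exact Or.inl (hdvd _ hj)
    · right
      obtain ⟨i, rfl⟩ := Nat.exists_eq_add_of_lt hjk
      exact hdvd _ ((dvd_pow_self _ (by omega)).trans (hdiv j hj i (by omega)))
  set ξ : ℤ → ZTau τ := fun i => if 0 ≤ i ∧ i < n then δ (s i.toNat) else 0 with hξ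
  have hnaf : IsWNaf w D ξ := by
    refine isWNaf_iff.2 ⟨fun j => ?_, fun i i' hi hi' => ?_⟩
    · simp only [hξ]
      split_ifs
      exacts [hmem _, hD.zero_mem]
    · simp only [hξ]
      split_ifs with h2 h3 h3
      · exact hblock _ _ (by omega) (by omega)
      · exact Or.inr rfl
      · exact Or.inl rfl
      · exact Or.inl rfl
  have hval : value ξ = ∑ j ∈ Finset.range n, (δ (s j) : ℂ) * τ ^ j := by
    unfold value
    rw [tsum_eq_sum (s := (Finset.range n).map Nat.castEmbedding)]
    · rw [Finset.sum_map]
      refine Finset.sum_congr rfl fun j hj => ?_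
      simp [hξ, Finset.mem_range.1 hj]
    · intro i hi
      have : ¬ (0 ≤ i ∧ i < n) := by
        rintro ⟨h2, h3⟩
        refine hi (Finset.mem_map.2 ⟨i.toNat, Finset.mem_range.2 (by omega), ?_⟩)
        simp [h2]
      simp [hξ, this]
  refine ⟨s n, fun j => ξ (j + n), ⟨hnaf.shift n, fun j hj => ?_⟩, ?_⟩
  · simp only [hξ]
    rw [if_neg (by omega)]
  · rw [value_shift hτ0, hval, hsum n, zpow_neg, zpow_natCast]
    field_simp
    ring

open scoped Pointwise in
/-- The lattice translates of the fundamental domain cover the plane: their union is closed, as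
the lattice is closed and the fundamental domain compact, and it contains a dense set. -/
theorem exists_sub_mem_fundamentalDomain_of_complex (hτ : τ ^ 2 - (p : ℂ) * τ + (q : ℂ) = 0)
    (hpq : 0 < 4 * q - p ^ 2) (h1 : 1 < ‖τ‖) (hw : 1 ≤ w) (hD : IsReducedResidueDigitSet τ w D)
    (hfin : D.Finite) (z : ℂ) : ∃ y : ZTau τ, z - y ∈ fundamentalDomain w D := by
  have hclosed : IsClosed (Set.range ((↑) : ZTau τ → ℂ) + fundamentalDomain w D) :=
    (isClosed_range_coe hτ hpq).add_right_of_isCompact (isCompact_fundamentalDomain h1 hfin)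
  have hz : z ∈ closure (Set.range ((↑) : ZTau τ → ℂ) + fundamentalDomain w D) := by
    refine Metric.mem_closure_iff.2 fun ε hε => ?_
    obtain ⟨n, x, hx⟩ := exists_norm_sub_div_pow_lt (im_ne_zero_of_quadratic hτ hpq) h1 z hε
    obtain ⟨y, hy⟩ := hD.exists_sub_mem_fundamentalDomain h1 hw x n
    refine ⟨(x : ℂ) / τ ^ n, ?_, by rwa [dist_eq_norm]⟩
    exact Set.mem_add.2 ⟨y, ⟨y, rfl⟩, _, hy, by ring⟩
  rw [hclosed.closure_eq] at hz
  obtain ⟨_, ⟨y, rfl⟩, t, ht, rfl⟩ := Set.mem_add.1 hz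
  exact ⟨y, by simpa using ht⟩

/-- By Baire's theorem, one of the countably many closed translates that cover the plane has an
interior point. -/
theorem nonempty_interior_fundamentalDomain (hτ : τ ^ 2 - (p : ℂ) * τ + (q : ℂ) = 0)
    (hpq : 0 < 4 * q - p ^ 2) (h1 : 1 < ‖τ‖) (hw : 1 ≤ w) (hD : IsReducedResidueDigitSet τ w D)
    (hfin : D.Finite) : (interior (fundamentalDomain w D)).Nonempty := by
  have := countable_ZTau hτ
  have hclosed := (isCompact_fundamentalDomain (w := w) h1 hfin).isClosed
  obtain ⟨y, x, hx⟩ := nonempty_interior_of_iUnion_of_closed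
    (f := fun y : ZTau τ => (Homeomorph.subRight (y : ℂ)) ⁻¹' fundamentalDomain w D)
    (fun y => hclosed.preimage (Homeomorph.continuous _))
    (Set.eq_univ_of_forall fun z => Set.mem_iUnion.2
      (exists_sub_mem_fundamentalDomain_of_complex hτ hpq h1 hw hD hfin z))
  rw [← Homeomorph.preimage_interior] at hx
  exact ⟨_, hx⟩

/-! ### The iterated function system of the fundamental domain -/

/-- The affine map `z ↦ b + a z` of the plane, for `a ≠ 0`. -/
noncomputable def affineHomeo (a : ℂ) (ha : a ≠ 0) (b : ℂ) : ℂ ≃ₜ ℂ :=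
  (Homeomorph.mulLeft₀ a ha).trans (Homeomorph.addLeft b)

theorem affineHomeo_apply (a : ℂ) (ha : a ≠ 0) (b z : ℂ) : affineHomeo a ha b z = b + a * z := rfl

theorem lipschitzWith_affineHomeo (a : ℂ) (ha : a ≠ 0) (b : ℂ) :
    LipschitzWith ‖a‖₊ (affineHomeo a ha b) := by
  refine LipschitzWith.of_dist_le_mul fun x y => ?_
  rw [affineHomeo_apply, affineHomeo_apply, dist_add_left, dist_eq_norm, dist_eq_norm, ← mul_sub,
    norm_mul, coe_nnnorm]

theorem dimH_frontier_fundamentalDomain_lt (hτ : τ ^ 2 - (p : ℂ) * τ + (q : ℂ) = 0)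
    (hpq : 0 < 4 * q - p ^ 2) (h1 : 1 < ‖τ‖) (hw : 1 ≤ w) (hD : IsReducedResidueDigitSet τ w D) :
    dimH (frontier (fundamentalDomain w D)) < 2 := by
  have hτ0 : τ ≠ 0 := fun h => by norm_num [h] at h1
  have hq : ‖τ‖ ^ 2 = q := by
    rw [← Complex.normSq_eq_norm_sq, normSq_of_quadratic hτ hpq]
  have hq1 : 1 < q := by
    have : (1 : ℝ) < q := by
      rw [← hq]
      exact one_lt_pow₀ h1 two_ne_zero
    exact_mod_cast this
  obtain ⟨Q, hQ⟩ := Int.eq_ofNat_of_zero_le (by omega : 0 ≤ q)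
  obtain ⟨w, rfl⟩ : ∃ k, w = k + 1 := ⟨w - 1, by omega⟩
  obtain ⟨hfin0, hcard⟩ := hD.finite_and_ncard_le hτ hQ.symm (by omega)
  have hfin : D.Finite := (hfin0.union (Set.finite_singleton 0)).subset (by simp)
  have : Fintype (D \ {0} : Set (ZTau τ)) := hfin0.fintype
  have ha : τ⁻¹ ≠ 0 := inv_ne_zero hτ0
  have hb : (τ ^ (w + 1))⁻¹ ≠ 0 := inv_ne_zero (pow_ne_zero _ hτ0)
  -- the ratios are `|τ|⁻¹`, and `|τ|⁻ʷ` for each of the non-zero digits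
  let r : Option (D \ {0} : Set (ZTau τ)) → NNReal :=
    fun o => o.elim ‖τ⁻¹‖₊ fun _ => ‖(τ ^ (w + 1))⁻¹‖₊
  let f : Option (D \ {0} : Set (ZTau τ)) → ℂ ≃ₜ ℂ :=
    fun o => o.elim (affineHomeo τ⁻¹ ha 0) fun d => affineHomeo (τ ^ (w + 1))⁻¹ hb (d.1 * τ⁻¹)
  have key := dimH_frontier_lt_of_selfSimilar (f := f) (r := r) (d := 2) (c := ‖τ⁻¹‖₊)
    (K := fundamentalDomain (w + 1) D) two_pos ?_ ?_ ?_ ?_ ?_ ?_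
    (isCompact_fundamentalDomain h1 hfin) (nonempty_interior_fundamentalDomain hτ hpq h1 hw hD hfin)
  · simpa using key
  · rintro (_ | d)
    exacts [lipschitzWith_affineHomeo _ _ _, lipschitzWith_affineHomeo _ _ _]
  · rintro (_ | d)
    exacts [nnnorm_pos.2 ha, nnnorm_pos.2 hb]
  · rintro (_ | d)
    · exact le_rfl
    · change ‖(τ ^ (w + 1))⁻¹‖ ≤ ‖τ⁻¹‖
      rw [← inv_pow, norm_pow, pow_succ]
      refine mul_le_of_le_one_left (norm_nonneg _) (pow_le_one₀ (norm_nonneg _) ?_)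
      rw [norm_inv]
      exact inv_le_one_of_one_le₀ h1.le
  · change ‖τ⁻¹‖ < 1
    rw [norm_inv]
    exact inv_lt_one_of_one_lt₀ h1
  · -- `q⁻¹ + (q - 1) q ^ (w - 1) * q⁻ʷ = 1`
    rw [Fintype.sum_option, ← NNReal.coe_le_coe]
    simp only [r, Option.elim, Finset.sum_const, Finset.card_univ]
    push_cast
    rw [← Nat.card_eq_fintype_card, Nat.card_coe_set_eq, nsmul_eq_mul]
    have hq' : ‖τ‖ ^ 2 = Q := by rw [hq, hQ]; simp
    have hQ1 : (1 : ℝ) < Q := by exact_mod_cast (show 1 < Q by omega)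
    have hN : ((D \ {0} : Set (ZTau τ)).ncard : ℝ) ≤ (Q - 1) * Q ^ w := by
      have : ((D \ {0} : Set (ZTau τ)).ncard : ℝ) ≤ (((Q - 1) * Q ^ w : ℕ) : ℝ) := by
        exact_mod_cast hcard
      rwa [Nat.cast_mul, Nat.cast_sub (by omega), Nat.cast_pow, Nat.cast_one] at this
    rw [Real.rpow_two, Real.rpow_two, norm_inv, norm_inv, norm_pow, inv_pow, inv_pow, ← pow_mul,
      mul_comm (w + 1) 2, pow_mul, hq']
    calc (Q : ℝ)⁻¹ + (D \ {0} : Set (ZTau τ)).ncard * ((Q : ℝ) ^ (w + 1))⁻¹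
        ≤ (Q : ℝ)⁻¹ + ((Q - 1) * Q ^ w) * ((Q : ℝ) ^ (w + 1))⁻¹ := by gcongr
      _ = 1 := by
        field_simp
        ring
  · ext z
    constructor
    · intro hz
      rcases exists_of_mem_fundamentalDomain h1 hw hfin hD.zero_mem hz with
        ⟨y, hy, rfl⟩ | ⟨d, hd, y, hy, rfl⟩
      · exact Set.mem_iUnion.2 ⟨none, y, hy, zero_add _⟩
      · exact Set.mem_iUnion.2 ⟨some ⟨d, hd⟩, y, hy, rfl⟩
    · intro hz
      obtain ⟨_ | d, y, hy, rfl⟩ := Set.mem_iUnion.1 hz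
      · have := inv_mul_mem_fundamentalDomain hτ0 hy
        rwa [← zero_add (τ⁻¹ * y)] at this
      · exact digit_add_mul_mem_fundamentalDomain h1 hw hfin d.2.1 hy

end Naf

theorem volume_eq_zero_of_dimH_lt {s : Set ℂ} (h : dimH s < 2) : volume s = 0 := by
  have hH : (Measure.hausdorffMeasure (X := ℂ) ((2 : NNReal) : ℝ)).IsAddHaarMeasure := by
    have := isAddHaarMeasure_hausdorffMeasure (E := ℂ)
    rw [Complex.finrank_real_complex] at this
    simpa using this
  exact measure_zero_of_dimH_lt (d := 2)
    (Measure.absolutelyContinuous_isAddHaarMeasure volume _) (by simpa using h)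

end WNaf

theorem mainTheorem5 (τ : ℂ) (p q : ℤ) (hτ : τ ^ 2 - (p : ℂ) * τ + (q : ℂ) = 0)
    (hpq : 0 < 4 * q - p ^ 2) (hτ1 : 1 < ‖τ‖) (w : ℕ) (hw : 2 ≤ w)
    (m : ℕ) (v : ZMod m → ℂ) (hv : WNaf.IsVertexLabelling τ m v)
    (D : Set (WNaf.ZTau τ)) (hD : WNaf.IsMinNormDigitSet τ w m v D) :
    dimH (frontier (WNaf.fundamentalDomain w D)) < 2 ∧
      volume (frontier (WNaf.fundamentalDomain w D)) = 0 := by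
  have h := WNaf.dimH_frontier_fundamentalDomain_lt hτ hpq hτ1 (by omega) hD.reducedResidue
  exact ⟨h, WNaf.volume_eq_zero_of_dimH_lt h⟩
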